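/- Let $k$ be a commutative ring and let $\mathbf{a}$ be an essentially small $k$-linear category. Write $\mathsf{PSh}\,\mathbf{a}$ for the category of $k$-linear functors $\mathbf{a}^{\mathrm{op}}\to\mathsf{Mod}_k$ and $\mathtt{Y}:\mathbf{a}\to\mathsf{PSh}\,\mathbf{a}$ for the Yoneda embedding. A sieve on $A\in\mathbf{a}$ is a $k$-linear subfunctor of $\mathbf{a}(-,A)$. A topology $\mathcal{T}$ on $\mathbf{a}$ is a $k$-linear Grothendieck topology: it assigns to each $A\in\mathbf{a}$ a set $\mathcal{T}(A)$ of sieves on $A$ such that $\mathbf{a}(-,A)\in\mathcal{T}(A)$; if $R\in\mathcal{T}(A)$ and $f:B\to A$, then $f^{-1}R\in\mathcal{T}(B)$; and if $S$ is a sieve on $A$ for which there is $R\in\mathcal{T}(A)$ such that $f^{-1}S\in\mathcal{T}(B)$ for all $B\in\mathbf{a}$ and $f\in R(B)$, then $S\in\mathcal{T}(A)$. A topology $\mathcal{T}'$ is finer than $\mathcal{T}$ if $\mathcal{T}(A)\subset\mathcal{T}'(A)$ for all $A$, and the join $\vee_i\mathcal{T}_i$ of a family of topologies is the coarsest topology containing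 all $\mathcal{T}_i$. A presheaf $F$ is a $\mathcal{T}$-sheaf if $\mathrm{Nat}(\mathbf{a}(-,A),F)\to\mathrm{Nat}(R,F)$ is an isomorphism for all $A\in\mathbf{a}$ and $R\in\mathcal{T}(A)$; let $\mathsf{Sh}(\mathbf{a},\mathcal{T})\subset\mathsf{PSh}\,\mathbf{a}$ be the full subcategory of $\mathcal{T}$-sheaves and $\mathtt{S}$ the left adjoint of its inclusion (sheafification). The topology $\mathcal{T}$ is subcanonical if every representable presheaf $\mathbf{a}(-,A)$ is a $\mathcal{T}$-sheaf, and noetherian if for every $X\in\mathbf{a}$ the object $\mathtt{S}(\mathtt{Y}(X))$ is compact in $\mathsf{Sh}(\mathbf{a},\mathcal{T})$, i.e. the functor $\mathsf{Sh}(\mathbf{a},\mathcal{T})(\mathtt{S}(\mathtt{Y}(X)),-)$ commutes with filtered colimits. Then: (i) There exists a unique finest subcanonical topology on $\mathbf{a}$ (the canonical topology). It is given by $\vee_i\mathcal{T}_i$, for $\mathcal{T}_i$ ranging over all subcanonical topologies. (ii) There exists a unique finest subcanonical noetherian topology on $\mathbf{a}$ (the canonical noetherian topology). It is given by $\vee_i\mathcal{T}_i$,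 for $\mathcal{T}_i$ ranging over all subcanonical noetherian topologies. -/

import Mathlib

open CategoryTheory Opposite

universe v u

noncomputable section

namespace LinearTopos

section Sieves

variable (k : Type v) [CommRing k] {C : Type u} [Category.{v} C] [Preadditive C] [Linear k C]

/-- A `k`-linear sieve on `A`: a `k`-linear subfunctor of the representable presheaf `C(-, A)`,
that is, a submodule of each `C(B, A)`, stable under precomposition. -/
@[ext]
structure LinearSieve (A : C) where
  /-- The submodule of the morphisms `B ⟶ A` that belong to the sieve. -/
  hom : ∀ B : C, Submodule k (B ⟶ A)
  comp_mem : ∀ {B B' : C} (g : B' ⟶ B) {f : B ⟶ A}, f ∈ hom B → g ≫ f ∈ hom B'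

namespace LinearSieve

variable {k}

/-- The maximal sieve `C(-, A)`. -/
def maximal (A : C) : LinearSieve k A where
  hom _ := ⊤
  comp_mem _ _ _ := trivial

/-- The inverse image `f⁻¹R`: the sieve of all `g` such that `f ∘ g` belongs to `R`. -/
def pullback {A B : C} (f : B ⟶ A) (R : LinearSieve k A) : LinearSieve k B where
  hom D := (R.hom D).comap (Linear.rightComp k D f)
  comp_mem {D D'} g h hh := by
    have := R.comp_mem g hh
    simpa using this

@[simp]
lemma mem_pullback {A B D : C} (f : B ⟶ A) (R : LinearSieve k A) (g : D ⟶ B) :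
    g ∈ (R.pullback f).hom D ↔ g ≫ f ∈ R.hom D := Iff.rfl

end LinearSieve

end Sieves

section Presheaves

variable (k : Type v) [CommRing k] (C : Type u) [Category.{v} C] [Preadditive C] [Linear k C]

/-- A functor `Cᵒᵖ ⥤ Mod_k` is `k`-linear if it acts `k`-linearly on morphisms. -/
structure IsLinearPresheaf (F : Cᵒᵖ ⥤ ModuleCat.{v} k) : Prop where
  map_add : ∀ {A B : C} (f g : A ⟶ B), F.map (f + g).op = F.map f.op + F.map g.op
  map_smul : ∀ {A B : C} (r : k) (f : A ⟶ B), F.map (r • f).op = r • F.map f.op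

/-- `PSh C`: the category of `k`-linear functors `Cᵒᵖ ⥤ Mod_k`. -/
abbrev LinearPresheaf : Type (max u (v + 1)) :=
  ObjectProperty.FullSubcategory
    (fun F : Cᵒᵖ ⥤ ModuleCat.{v} k => IsLinearPresheaf k C F)

/-- The linear Yoneda embedding `Y : C ⥤ PSh C`. -/
def yonedaEmbedding : C ⥤ LinearPresheaf k C :=
  ObjectProperty.lift _ (linearYoneda k C) (fun A =>
    { map_add := fun f g => by
        ext h
        exact Preadditive.add_comp _ _ _ f g h
      map_smul := fun r f => by
        ext h
        exact Linear.smul_comp _ _ _ r f h })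

variable {k C}

/-- A sieve on `A`, regarded as a presheaf. -/
def LinearSieve.toPresheaf {A : C} (R : LinearSieve k A) : LinearPresheaf k C where
  obj :=
    { obj := fun B => ModuleCat.of k (R.hom B.unop)
      map := fun {B B'} g => ModuleCat.ofHom
        ((Linear.leftComp k A g.unop).restrict (fun _ hf => R.comp_mem g.unop hf))
      map_id := fun B => by
        ext f
        exact Category.id_comp f.1
      map_comp := fun g h => by
        ext f
        exact Category.assoc h.unop g.unop f.1 }
  property :=
    { map_add := fun f g => by
        ext h
        exact Preadditive.add_comp _ _ _ f g h.1
      map_smul := fun r f => by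
        ext h
        exact Linear.smul_comp _ _ _ r f h.1 }

/-- The inclusion of presheaves `R ⟶ C(-, A)` of a sieve `R` on `A`. -/
def LinearSieve.inclusion {A : C} (R : LinearSieve k A) :
    R.toPresheaf ⟶ (yonedaEmbedding k C).obj A :=
  ObjectProperty.homMk
    { app := fun B => ModuleCat.ofHom (R.hom B.unop).subtype
      naturality := fun _ _ _ => rfl }

end Presheaves

section Topologies

variable (k : Type v) [CommRing k] (C : Type u) [Category.{v} C] [Preadditive C] [Linear k C]

/-- A `k`-linear Grothendieck topology on `C`. -/
@[ext]
structure LinearTopology where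
  /-- The set of covering sieves on `A`. -/
  cov : ∀ A : C, Set (LinearSieve k A)
  maximal_mem : ∀ A : C, LinearSieve.maximal A ∈ cov A
  pullback_mem : ∀ {A B : C} (f : B ⟶ A) {R : LinearSieve k A}, R ∈ cov A →
    R.pullback f ∈ cov B
  transitive : ∀ {A : C} (S : LinearSieve k A) {R : LinearSieve k A}, R ∈ cov A →
    (∀ (B : C) (f : B ⟶ A), f ∈ R.hom B → S.pullback f ∈ cov B) → S ∈ cov A

namespace LinearTopology

variable {k C}

/-- Topologies are ordered by inclusion: `T ≤ T'` if `T A ⊆ T' A` for all objects `A`, that is,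
if `T'` is finer than `T`. -/
instance : PartialOrder (LinearTopology k C) :=
  PartialOrder.lift LinearTopology.cov (fun _ _ h => LinearTopology.ext h)

lemma le_iff {T T' : LinearTopology k C} : T ≤ T' ↔ ∀ A : C, T.cov A ⊆ T'.cov A := Iff.rfl

/-- The meet of a set of topologies is their intersection. -/
instance : InfSet (LinearTopology k C) where
  sInf 𝒮 :=
    { cov := fun A => {R | ∀ T ∈ 𝒮, R ∈ T.cov A}
      maximal_mem := fun A T _ => T.maximal_mem A
      pullback_mem := fun f _ hR T hT => T.pullback_mem f (hR T hT)
      transitive := fun S _ hR h T hT =>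
        T.transitive S (hR T hT) (fun B f hf => h B f hf T hT) }

/-- The topologies form a complete lattice, where the join `sSup 𝒮` of a set `𝒮` of topologies is
the coarsest topology that contains all of them, that is, the intersection of all
topologies that contain every member of `𝒮`. -/
instance : CompleteLattice (LinearTopology k C) :=
  completeLatticeOfInf _ (fun _ =>
    ⟨fun T hT _ _ hR => hR T hT, fun _ hT _ _ hR _ hT' => hT hT' _ hR⟩)

variable (T : LinearTopology k C)

/-- A presheaf `F` is a `T`-sheaf if restriction `Nat(C(-, A), F) ⟶ Nat(R, F)` along the inclusion
`R ⟶ C(-, A)` is an isomorphism for all `A` and all `R` in `T A`. -/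
def IsSheaf : ObjectProperty (LinearPresheaf k C) := fun F =>
  ∀ (A : C) (R : LinearSieve k A), R ∈ T.cov A →
    Function.Bijective (fun φ : (yonedaEmbedding k C).obj A ⟶ F => R.inclusion ≫ φ)

/-- `Sh(C, T)`: the full subcategory of `PSh C` of `T`-sheaves. -/
abbrev Sh : Type (max u (v + 1)) := T.IsSheaf.FullSubcategory

/-- The inclusion `I : Sh(C, T) ⥤ PSh C`. -/
abbrev incl : T.Sh ⥤ LinearPresheaf k C := T.IsSheaf.ι

/-- `T` is subcanonical if every representable presheaf is a `T`-sheaf. -/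
def IsSubcanonical : Prop := ∀ A : C, T.IsSheaf ((yonedaEmbedding k C).obj A)

/-- `T` is noetherian if `Z(X) = S(Y(X))` is a compact object of `Sh(C, T)` for every object `X`,
where `S` is the sheafification, i.e. the left adjoint (unique up to isomorphism) of the inclusion
`I : Sh(C, T) ⥤ PSh C`. -/
def IsNoetherian : Prop :=
  ∃ (S : LinearPresheaf k C ⥤ T.Sh) (_ : S ⊣ T.incl),
    ∀ X : C, IsFinitelyPresentable.{v} ((yonedaEmbedding k C ⋙ S).obj X)

end LinearTopology

end Topologies

end LinearTopos

end

/-! For each presheaf `F` there is a finest topology for which `F` is a sheaf: its covers are the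
sieves all of whose inverse images satisfy the sheaf condition for `F` (`finestTopology`). Hence `F`
is a sheaf for a join of topologies iff it is a sheaf for each of them (`isSheaf_sSup_iff`), so
joins of subcanonical topologies are subcanonical.

A topology is noetherian iff its sheaves are closed under filtered colimits of presheaves, a
condition that passes to intersections of classes of sheaves. If it is noetherian, `Hom(S(Y A), F) =
F(A)` shows that sections of sheaves commute with filtered colimits. Conversely, representables are
compact, and a left adjoint preserves compactness when its right adjoint preserves filtered
colimits. The converse needs sheafification for the join: essential smallness makes sheaves the
local objects for a small set of maps in a locally presentable category. -/

noncomputable section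

namespace LinearTopos

open Limits

section

variable {k : Type v} [CommRing k] {C : Type u} [Category.{v} C] [Preadditive C] [Linear k C]

/-! ### Sections, the Yoneda lemma and the sheaf condition by amalgamation. -/

namespace LinearPresheaf

variable (F : LinearPresheaf k C)

/-- The restriction of sections of a linear presheaf along a morphism. -/
def restrict {A B : C} (f : B ⟶ A) : F.obj.obj (op A) →ₗ[k] F.obj.obj (op B) :=
  (F.obj.map f.op).hom

@[simp]
lemma restrict_id (A : C) (x : F.obj.obj (op A)) : restrict F (𝟙 A) x = x := by
  simp [restrict]

lemma restrict_comp {A B D : C} (g : D ⟶ B) (f : B ⟶ A) (x : F.obj.obj (op A)) :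
    restrict F (g ≫ f) x = restrict F g (restrict F f x) := by
  simp [restrict]

lemma restrict_add {A B : C} (f g : B ⟶ A) (x : F.obj.obj (op A)) :
    restrict F (f + g) x = restrict F f x + restrict F g x := by
  change (F.obj.map (f + g).op).hom x = _
  rw [F.property.map_add]
  rfl

lemma restrict_smul {A B : C} (r : k) (f : B ⟶ A) (x : F.obj.obj (op A)) :
    restrict F (r • f) x = r • restrict F f x := by
  change (F.obj.map (r • f).op).hom x = _
  rw [F.property.map_smul]
  rfl

lemma app_restrict {F G : LinearPresheaf k C} (φ : F ⟶ G) {A B : C} (f : B ⟶ A)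
    (x : F.obj.obj (op A)) :
    (φ.hom.app (op B)).hom (restrict F f x) = restrict G f ((φ.hom.app (op A)).hom x) :=
  LinearMap.congr_fun (congrArg ModuleCat.Hom.hom (φ.hom.naturality f.op)) x

lemma hom_ext {F G : LinearPresheaf k C} {φ ψ : F ⟶ G}
    (h : ∀ (A : C) (x : F.obj.obj (op A)),
      (φ.hom.app (op A)).hom x = (ψ.hom.app (op A)).hom x) : φ = ψ := by
  apply ObjectProperty.hom_ext
  ext A x
  exact h A.unop x

/-- The morphism of linear presheaves given by a compatible family of linear maps. -/
def mkHom {F G : LinearPresheaf k C}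
    (s : ∀ A : C, F.obj.obj (op A) →ₗ[k] G.obj.obj (op A))
    (hs : ∀ {A B : C} (f : B ⟶ A) (x : F.obj.obj (op A)),
      s B (restrict F f x) = restrict G f (s A x)) : F ⟶ G :=
  ObjectProperty.homMk
    { app := fun A => ModuleCat.ofHom (s A.unop)
      naturality := fun A B f => by
        ext x
        exact hs f.unop x }

/-- The Yoneda lemma for linear presheaves. -/
def yonedaEquiv {A : C} : ((yonedaEmbedding k C).obj A ⟶ F) ≃ F.obj.obj (op A) where
  toFun φ := (φ.hom.app (op A)).hom (𝟙 A : A ⟶ A)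
  invFun x := mkHom (F := (yonedaEmbedding k C).obj A)
    (fun B =>
      { toFun := fun f => restrict F (show B ⟶ A from f) x
        map_add' := fun f g => restrict_add F (show B ⟶ A from f) g x
        map_smul' := fun r f => restrict_smul F r (show B ⟶ A from f) x })
    (fun f g => restrict_comp F f (show _ ⟶ A from g) x)
  left_inv φ := by
    apply hom_ext
    intro B f
    exact (app_restrict φ f (𝟙 A : A ⟶ A)).symm.trans
      (congrArg (φ.hom.app (op B)).hom (Category.comp_id (show B ⟶ A from f)))
  right_inv x := restrict_id F A x

lemma app_eq_restrict_yonedaEquiv {A B : C} (φ : (yonedaEmbedding k C).obj A ⟶ F) (f : B ⟶ A) :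
    (φ.hom.app (op B)).hom f = restrict F f (yonedaEquiv F φ) := by
  conv_lhs => rw [← (yonedaEquiv F).symm_apply_apply φ]
  rfl

lemma yonedaEquiv_comp {F G : LinearPresheaf k C} {A : C}
    (φ : (yonedaEmbedding k C).obj A ⟶ F) (ψ : F ⟶ G) :
    yonedaEquiv G (φ ≫ ψ) = (ψ.hom.app (op A)).hom (yonedaEquiv F φ) := rfl

/-- A family of sections of `F` indexed by the morphisms of the sieve `R` is compatible if it
commutes with restriction. -/
def IsCompatible {A : C} {R : LinearSieve k A} (s : ∀ B : C, R.hom B →ₗ[k] F.obj.obj (op B)) :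
    Prop :=
  ∀ ⦃B D : C⦄ (g : D ⟶ B) (f : B ⟶ A) (hf : f ∈ R.hom B),
    s D ⟨g ≫ f, R.comp_mem g hf⟩ = restrict F g (s B ⟨f, hf⟩)

variable {F} in
/-- The family on the sieve `f⁻¹R` induced by a family of sections on the sieve `R`. -/
def pullbackFamily {A B : C} {R : LinearSieve k A} (f : B ⟶ A)
    (s : ∀ D : C, R.hom D →ₗ[k] F.obj.obj (op D)) (D : C) :
    (R.pullback f).hom D →ₗ[k] F.obj.obj (op D) :=
  (s D).comp ((Linear.rightComp k D f).restrict
    (p := (R.pullback f).hom D) (q := R.hom D) (fun _ hg => hg))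

variable {F} in
lemma IsCompatible.pullback {A B : C} {R : LinearSieve k A}
    {s : ∀ D : C, R.hom D →ₗ[k] F.obj.obj (op D)} (hs : IsCompatible F s) (f : B ⟶ A) :
    IsCompatible F (pullbackFamily f s) := by
  intro D E g g' hg'
  refine Eq.trans ?_ (hs g (g' ≫ f) hg')
  exact congrArg (s E) (Subtype.ext (Category.assoc _ _ _))

/-- A section of `F` is determined by its restrictions along the morphisms of the sieve `R`. -/
def IsSeparatedFor {A : C} (R : LinearSieve k A) : Prop :=
  ∀ x y : F.obj.obj (op A),
    (∀ (B : C) (f : B ⟶ A), f ∈ R.hom B → restrict F f x = restrict F f y) → x = y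

/-- Every compatible family of sections of `F` along the sieve `R` has a unique amalgamation. -/
def IsSheafFor {A : C} (R : LinearSieve k A) : Prop :=
  IsSeparatedFor F R ∧
    ∀ s : ∀ B : C, R.hom B →ₗ[k] F.obj.obj (op B), IsCompatible F s →
      ∃ x : F.obj.obj (op A), ∀ (B : C) (f : B ⟶ A) (hf : f ∈ R.hom B),
        s B ⟨f, hf⟩ = restrict F f x

lemma bijective_inclusion_comp_iff {A : C} (R : LinearSieve k A) :
    Function.Bijective
      (fun φ : (yonedaEmbedding k C).obj A ⟶ F => R.inclusion ≫ φ) ↔ IsSheafFor F R := by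
  have key : ∀ (φ : (yonedaEmbedding k C).obj A ⟶ F) (B : C) (f : B ⟶ A) (hf : f ∈ R.hom B),
      ((R.inclusion ≫ φ).hom.app (op B)).hom ⟨f, hf⟩ = restrict F f (yonedaEquiv F φ) :=
    fun φ B f hf => app_eq_restrict_yonedaEquiv F φ f
  constructor
  · rintro ⟨hi, hs⟩
    refine ⟨fun x y h => ?_, fun s hc => ?_⟩
    · apply (yonedaEquiv F).symm.injective
      apply hi
      apply hom_ext
      rintro B ⟨f, hf⟩
      rw [key _ B f hf, key _ B f hf]
      simpa using h B f hf
    · obtain ⟨φ, hφ⟩ := hs (mkHom (F := R.toPresheaf) s (fun g f => hc g f.1 f.2))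
      refine ⟨yonedaEquiv F φ, fun B f hf => ?_⟩
      rw [← key φ B f hf]
      simp only [hφ]
      rfl
  · rintro ⟨hi, hs⟩
    refine ⟨fun φ ψ h => ?_, fun σ => ?_⟩
    · apply (yonedaEquiv F).injective
      apply hi
      intro B f hf
      rw [← key _ B f hf, ← key _ B f hf]
      simp only at h
      rw [h]
    · obtain ⟨x, hx⟩ := hs (fun B => (σ.hom.app (op B)).hom)
        (fun B D g f hf => app_restrict σ g (⟨f, hf⟩ : R.hom B))
      refine ⟨(yonedaEquiv F).symm x, ?_⟩
      apply hom_ext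
      rintro B ⟨f, hf⟩
      refine (key _ B f hf).trans ?_
      rw [Equiv.apply_symm_apply]
      exact (hx B f hf).symm

end LinearPresheaf

/-! ### Linear sieves and the finest topology for a presheaf. -/

namespace LinearSieve

lemma ext_mem {A : C} {R S : LinearSieve k A}
    (h : ∀ (B : C) (f : B ⟶ A), f ∈ R.hom B ↔ f ∈ S.hom B) : R = S := by
  ext B f
  exact h B f

lemma pullback_comp {A B D : C} (g : D ⟶ B) (f : B ⟶ A) (R : LinearSieve k A) :
    R.pullback (g ≫ f) = (R.pullback f).pullback g :=
  ext_mem fun _ _ => by simp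

@[simp]
lemma pullback_id {A : C} (R : LinearSieve k A) : R.pullback (𝟙 A) = R :=
  ext_mem fun _ _ => by simp

lemma pullback_eq_maximal {A B : C} (R : LinearSieve k A) {f : B ⟶ A} (hf : f ∈ R.hom B) :
    R.pullback f = maximal B :=
  ext_mem fun _ g => by simpa [maximal] using R.comp_mem g hf

lemma pullback_maximal {A B : C} (f : B ⟶ A) :
    (maximal A : LinearSieve k A).pullback f = maximal B :=
  pullback_eq_maximal _ trivial

/-- The intersection of two linear sieves. -/
def inter {A : C} (R S : LinearSieve k A) : LinearSieve k A where
  hom B := R.hom B ⊓ S.hom B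
  comp_mem g _ hf := ⟨R.comp_mem g hf.1, S.comp_mem g hf.2⟩

end LinearSieve

namespace LinearPresheaf

variable (F : LinearPresheaf k C)

lemma isSheafFor_maximal (A : C) : IsSheafFor F (LinearSieve.maximal A : LinearSieve k A) := by
  refine ⟨fun x y h => ?_, fun s hs => ⟨s A ⟨𝟙 A, trivial⟩, fun B f hf => ?_⟩⟩
  · simpa using h A (𝟙 A) trivial
  · rw [← hs f (𝟙 A) trivial]
    simp

/-- The sheaf condition holds universally for a sieve: it holds for all its inverse images. -/
def IsUniversalSheafFor {A : C} (R : LinearSieve k A) : Prop :=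
  ∀ (B : C) (f : B ⟶ A), IsSheafFor F (R.pullback f)

variable {F}

lemma IsUniversalSheafFor.isSheafFor {A : C} {R : LinearSieve k A}
    (h : IsUniversalSheafFor F R) : IsSheafFor F R := by
  simpa using h A (𝟙 A)

lemma IsUniversalSheafFor.pullback {A B : C} {R : LinearSieve k A}
    (h : IsUniversalSheafFor F R) (f : B ⟶ A) : IsUniversalSheafFor F (R.pullback f) := by
  intro D g
  rw [← LinearSieve.pullback_comp]
  exact h D (g ≫ f)

lemma isSeparatedFor_of_cover {A : C} {R S : LinearSieve k A} (hR : IsSeparatedFor F R)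
    (h : ∀ (B : C) (f : B ⟶ A), f ∈ R.hom B → IsSeparatedFor F (S.pullback f)) :
    IsSeparatedFor F S := by
  intro x y hxy
  refine hR x y fun B f hf => h B f hf _ _ fun D g hg => ?_
  rw [← restrict_comp, ← restrict_comp]
  exact hxy D _ hg

/-- Needed for linearity of gluing: amalgamations attached to `f`, `g` and `f + g` are comparable
only where both `f` and `g` pull back into the sieve. -/
lemma isSeparatedFor_inter {A : C} {R S : LinearSieve k A} (hR : IsSeparatedFor F R)
    (hS : IsUniversalSheafFor F S) : IsSeparatedFor F (R.inter S) := by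
  refine isSeparatedFor_of_cover hR fun B f hf => ?_
  have : (R.inter S).pullback f = S.pullback f :=
    LinearSieve.ext_mem fun D g =>
      ⟨fun h => h.2, fun h => ⟨R.comp_mem g hf, h⟩⟩
  rw [this]
  exact (hS B f).1

/-- Amalgamate over each `f` in `R`; by uniqueness these amalgamations form a compatible linear
family on `R`, which glues in turn. This gives transitivity of `finestTopology`. -/
lemma isSheafFor_of_cover {A : C} {R S : LinearSieve k A} (hR : IsUniversalSheafFor F R)
    (h : ∀ (B : C) (f : B ⟶ A), f ∈ R.hom B → IsUniversalSheafFor F (S.pullback f)) :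
    IsSheafFor F S := by
  refine ⟨isSeparatedFor_of_cover hR.isSheafFor.1 fun B f hf => (h B f hf).isSheafFor.1,
    fun s hs => ?_⟩
  have loc : ∀ (B : C) (f : R.hom B), ∃ t : F.obj.obj (op B), ∀ (D : C) (g : D ⟶ B)
      (hg : g ≫ f.1 ∈ S.hom D), s D ⟨g ≫ f.1, hg⟩ = restrict F g t := by
    intro B f
    exact (h B f.1 f.2).isSheafFor.2 _ (hs.pullback f.1)
  choose t ht using loc
  let t' : ∀ B : C, R.hom B →ₗ[k] F.obj.obj (op B) := fun B =>
    { toFun := t B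
      map_add' := fun f g => by
        refine isSeparatedFor_inter (h B f.1 f.2).isSheafFor.1 (h B g.1 g.2) _ _ ?_
        rintro D j ⟨hf, hg⟩
        replace hf : j ≫ f.1 ∈ S.hom D := hf
        replace hg : j ≫ g.1 ∈ S.hom D := hg
        have hfg : j ≫ (f + g).1 ∈ S.hom D := by
          simpa using add_mem hf hg
        rw [map_add, ← ht B f D j hf, ← ht B g D j hg, ← ht B (f + g) D j hfg, ← map_add]
        congr 2
        simp
      map_smul' := fun r f => by
        refine (h B f.1 f.2).isSheafFor.1 _ _ fun D j hf => ?_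
        replace hf : j ≫ f.1 ∈ S.hom D := hf
        have hrf : j ≫ (r • f).1 ∈ S.hom D := by
          simpa using (S.hom D).smul_mem r hf
        rw [RingHom.id_apply, map_smul, ← ht B f D j hf, ← ht B (r • f) D j hrf, ← map_smul]
        congr 2
        simp }
  obtain ⟨x, hx⟩ := hR.isSheafFor.2 t' (fun B D g f hf => by
    refine (h D (g ≫ f) (R.comp_mem g hf)).isSheafFor.1 _ _ fun E j hj => ?_
    replace hj : j ≫ g ≫ f ∈ S.hom E := hj
    have hj' : (j ≫ g) ≫ f ∈ S.hom E := by simpa using hj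
    rw [← restrict_comp]
    refine (ht D ⟨g ≫ f, R.comp_mem g hf⟩ E j hj).symm.trans
      (Eq.trans ?_ (ht B ⟨f, hf⟩ E (j ≫ g) hj'))
    congr 2
    simp)
  -- For `f` in `S`, the two sections are compared on `f⁻¹R`, where composites lie in both `R` and
  -- `S`.
  refine ⟨x, fun B f hf => (hR B f).1 _ _ fun D g hg => ?_⟩
  replace hg : g ≫ f ∈ R.hom D := hg
  have hgS := S.comp_mem g hf
  rw [← restrict_comp, ← hx D (g ≫ f) hg, ← hs g f hf]
  -- Since `g ≫ f` already lies in `S`, its local amalgamation `t` is the value of `s`, read off at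
  -- the identity.
  have := ht D ⟨g ≫ f, hg⟩ D (𝟙 D) (by simpa using hgS)
  rw [restrict_id] at this
  refine Eq.trans ?_ this
  congr 2
  simp

variable (F)

/-- The finest linear topology for which `F` is a sheaf. -/
def finestTopology : LinearTopology k C where
  cov A := {R | IsUniversalSheafFor F R}
  maximal_mem A B f := by
    rw [LinearSieve.pullback_maximal]
    exact isSheafFor_maximal F B
  pullback_mem f R hR := IsUniversalSheafFor.pullback hR f
  transitive S R hR h B f := by
    refine isSheafFor_of_cover (IsUniversalSheafFor.pullback hR f) fun D g hg => ?_
    rw [← LinearSieve.pullback_comp]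
    exact h D (g ≫ f) hg

/-- Covers of a topology are stable under inverse image, so the sheaf condition on them is
automatically universal. -/
lemma le_finestTopology_iff (T : LinearTopology k C) :
    T ≤ finestTopology F ↔ T.IsSheaf F := by
  constructor
  · intro h A R hR
    exact (bijective_inclusion_comp_iff F R).2 (IsUniversalSheafFor.isSheafFor (h A hR))
  · intro h A R hR B f
    exact (bijective_inclusion_comp_iff F _).1 (h B _ (T.pullback_mem f hR))

end LinearPresheaf

namespace LinearTopology

lemma isSheaf_sSup_iff (𝒮 : Set (LinearTopology k C)) (F : LinearPresheaf k C) :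
    (sSup 𝒮).IsSheaf F ↔ ∀ T ∈ 𝒮, T.IsSheaf F := by
  simp only [← LinearPresheaf.le_finestTopology_iff, sSup_le_iff]

lemma isSubcanonical_sSup {𝒮 : Set (LinearTopology k C)} (h : ∀ T ∈ 𝒮, T.IsSubcanonical) :
    (sSup 𝒮).IsSubcanonical :=
  fun A => (isSheaf_sSup_iff 𝒮 _).2 fun T hT => h T hT A

end LinearTopology

end

/-! ### Filtered colimits of sheaves and the noetherian condition. -/

section

section

variable (k : Type v) [CommRing k] (C : Type u) [Category.{v} C] [Preadditive C] [Linear k C]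

instance isClosedUnderColimitsOfShape_isLinearPresheaf (J : Type v) [SmallCategory J] :
    ObjectProperty.IsClosedUnderColimitsOfShape
      (fun F : Cᵒᵖ ⥤ ModuleCat.{v} k => IsLinearPresheaf k C F) J where
  colimitsOfShape_le := by
    rintro F ⟨p⟩
    have hc (A : C) := isColimitOfPreserves
      ((evaluation Cᵒᵖ (ModuleCat.{v} k)).obj (op A)) p.isColimit
    refine ⟨fun {A B} f g => (hc B).hom_ext fun j => ?_, fun {A B} r f => (hc B).hom_ext fun j => ?_⟩
    · let α : p.diag.obj j ⟶ F := p.ι.app j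
      change α.app (op B) ≫ F.map (f + g).op = α.app (op B) ≫ (F.map f.op + F.map g.op)
      rw [Preadditive.comp_add, ← α.naturality, ← α.naturality, ← α.naturality,
        (p.prop_diag_obj j).map_add, Preadditive.add_comp]
    · let α : p.diag.obj j ⟶ F := p.ι.app j
      change α.app (op B) ≫ F.map (r • f).op = α.app (op B) ≫ (r • F.map f.op)
      rw [Linear.comp_smul, ← α.naturality, ← α.naturality,
        (p.prop_diag_obj j).map_smul, Linear.smul_comp]

instance hasColimitsOfSize_linearPresheaf : HasColimitsOfSize.{v, v} (LinearPresheaf k C) where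
  has_colimits_of_shape _ _ := inferInstance

/-- The inclusion of linear presheaves into all presheaves of modules. -/
abbrev LinearPresheaf.forgetLinear : LinearPresheaf k C ⥤ Cᵒᵖ ⥤ ModuleCat.{v} k :=
  ObjectProperty.ι _

variable {C}

/-- The functor that sends a linear presheaf to its sections over an object. -/
abbrev LinearPresheaf.sections (A : C) : LinearPresheaf k C ⥤ ModuleCat.{v} k :=
  forgetLinear k C ⋙ (evaluation _ _).obj (op A)

/-- The Yoneda lemma, as an isomorphism of functors. -/
def LinearPresheaf.coyonedaIso (A : C) :
    coyoneda.obj (op ((yonedaEmbedding k C).obj A)) ≅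
      sections k A ⋙ forget (ModuleCat.{v} k) ⋙ uliftFunctor.{u} :=
  NatIso.ofComponents
    (fun F => ((yonedaEquiv F).trans Equiv.ulift.symm).toIso)
    (fun ψ => by ext φ; rfl)

instance isFinitelyPresentable_yonedaEmbedding_obj (A : C) :
    IsFinitelyPresentable.{v} ((yonedaEmbedding k C).obj A) := by
  rw [isFinitelyPresentable_iff_preservesFilteredColimitsOfSize]
  refine ⟨fun J _ _ => ?_⟩
  exact preservesColimitsOfShape_of_natIso (LinearPresheaf.coyonedaIso k A).symm

end

variable {k : Type v} [CommRing k] {C : Type u} [Category.{v} C] [Preadditive C] [Linear k C]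

namespace LinearTopology

instance (T : LinearTopology k C) : T.IsSheaf.IsClosedUnderIsomorphisms where
  of_iso {F G} e hF A R hR := by
    rw [← Function.Bijective.of_comp_iff _ (Iso.homToEquiv e).bijective]
    convert! (Iso.homToEquiv e).bijective.comp (hF A R hR) using 1

lemma IsNoetherian.isClosedUnderColimitsOfShape {T : LinearTopology k C} (hT : T.IsNoetherian)
    (J : Type v) [SmallCategory J] [IsFiltered J] :
    T.IsSheaf.IsClosedUnderColimitsOfShape J := by
  obtain ⟨S, adj, hS⟩ := hT
  let _ : Reflective T.incl := ⟨S, adj⟩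
  have : HasColimitsOfShape J T.Sh := hasColimitsOfShape_of_reflective T.incl
  -- Hom-sets of presheaves live in a larger universe than sections, hence the `uliftFunctor`. `U`
  -- reflects these colimits because it preserves them and reflects isomorphisms.
  let U := forget (ModuleCat.{v} k) ⋙ uliftFunctor.{u}
  have : ReflectsColimitsOfShape J U := reflectsColimitsOfShape_of_reflectsIsomorphisms
  have hsec (A : C) : PreservesColimitsOfShape J (T.incl ⋙ LinearPresheaf.sections k A) := by
    have : PreservesColimitsOfShape J
        (coyoneda.obj (op (S.obj ((yonedaEmbedding k C).obj A)))) :=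
      (isFinitelyPresentable_iff_preservesFilteredColimitsOfSize.1
        (hS A)).preserves_filtered_colimits J
    let e₁ : coyoneda.obj (op (S.obj ((yonedaEmbedding k C).obj A))) ≅
        T.incl ⋙ coyoneda.obj (op ((yonedaEmbedding k C).obj A)) :=
      NatIso.ofComponents (fun F => (adj.homEquiv _ F).toIso)
        (fun ψ => by ext φ; exact adj.homEquiv_naturality_right φ ψ)
    let e : coyoneda.obj (op (S.obj ((yonedaEmbedding k C).obj A))) ≅
        (T.incl ⋙ LinearPresheaf.sections k A) ⋙ U :=
      e₁ ≪≫ Functor.isoWhiskerLeft T.incl (LinearPresheaf.coyonedaIso k A)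
    have : PreservesColimitsOfShape J ((T.incl ⋙ LinearPresheaf.sections k A) ⋙ U) :=
      preservesColimitsOfShape_of_natIso e
    exact preservesColimitsOfShape_of_reflects_of_preserves _ U
  have : PreservesColimitsOfShape J (T.incl ⋙ LinearPresheaf.forgetLinear k C) :=
    preservesColimitsOfShape_of_evaluation _ J fun A => hsec A.unop
  have : PreservesColimitsOfShape J T.incl :=
    preservesColimitsOfShape_of_reflects_of_preserves _ (LinearPresheaf.forgetLinear k C)
  exact ObjectProperty.isClosedUnderColimitsOfShape_of_preservesColimitsOfShape_ι _ _

lemma isNoetherian_of_isClosedUnderColimitsOfShape (T : LinearTopology k C)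
    [T.incl.IsRightAdjoint]
    (h : ∀ (J : Type v) [SmallCategory J] [IsFiltered J],
      T.IsSheaf.IsClosedUnderColimitsOfShape J) : T.IsNoetherian := by
  have : T.incl.IsFinitelyAccessible := by
    rw [Functor.IsFinitelyAccessible_iff_preservesFilteredColimitsOfSize]
    refine ⟨fun J _ _ => ?_⟩
    have := h J
    infer_instance
  have := Cardinal.fact_isRegular_aleph0
  exact ⟨_, Adjunction.ofIsRightAdjoint T.incl, fun X =>
    (Adjunction.ofIsRightAdjoint T.incl).isCardinalPresentable_leftAdjoint_obj Cardinal.aleph0.{v}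
      ((yonedaEmbedding k C).obj X)⟩

lemma isClosedUnderColimitsOfShape_isSheaf_sSup (𝒮 : Set (LinearTopology k C))
    (J : Type v) [SmallCategory J]
    (h : ∀ T ∈ 𝒮, T.IsSheaf.IsClosedUnderColimitsOfShape J) :
    (sSup 𝒮).IsSheaf.IsClosedUnderColimitsOfShape J where
  colimitsOfShape_le F hF := (isSheaf_sSup_iff 𝒮 F).2 fun T hT =>
    (h T hT).colimitsOfShape_le F
      (ObjectProperty.colimitsOfShape_monotone J (fun G hG => (isSheaf_sSup_iff 𝒮 G).1 hG T hT) F hF)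

end LinearTopology

end

/-! ### Local presentability and the existence of sheafification. -/

section

section

variable {C : Type u} [Category.{v} C] [EssentiallySmall.{v} C]

/-- A chosen small family of objects that represents every isomorphism class. -/
def representative (A : SmallModel.{v} C) : C := (equivSmallModel.{v} C).inverse.obj A

lemma exists_iso_representative (A : C) :
    ∃ B : SmallModel.{v} C, Nonempty (representative B ≅ A) :=
  ⟨_, ⟨((equivSmallModel.{v} C).unitIso.app A).symm⟩⟩

end

variable {k : Type v} [CommRing k] {C : Type u} [Category.{v} C] [Preadditive C] [Linear k C]

lemma LinearPresheaf.restrict_injective_of_iso (F : LinearPresheaf k C) {A B : C} (e : B ≅ A)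
    {x y : F.obj.obj (op A)} (h : restrict F e.hom x = restrict F e.hom y) : x = y := by
  rw [← restrict_id F A x, ← restrict_id F A y, ← e.inv_hom_id, restrict_comp, h, restrict_comp]

lemma LinearPresheaf.isIso_of_bijective {F G : LinearPresheaf k C} (φ : F ⟶ G)
    (h : ∀ A : C, Function.Bijective (φ.hom.app (op A)).hom) : IsIso φ := by
  rw [← ObjectProperty.isIso_hom_iff, NatTrans.isIso_iff_isIso_app]
  intro A
  rw [ConcreteCategory.isIso_iff_bijective]
  exact h A.unop

section

variable [EssentiallySmall.{v} C]

instance locallySmall_linearPresheaf : LocallySmall.{v} (LinearPresheaf k C) where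
  hom_small F G := by
    refine small_of_injective (β := ∀ B : SmallModel.{v} C,
      F.obj.obj (op (representative B)) → G.obj.obj (op (representative B)))
      (f := fun φ B x => (φ.hom.app (op (representative B))).hom x) fun φ ψ h =>
        LinearPresheaf.hom_ext fun A x => ?_
    obtain ⟨B, ⟨e⟩⟩ := exists_iso_representative A
    apply LinearPresheaf.restrict_injective_of_iso G e
    rw [← LinearPresheaf.app_restrict, ← LinearPresheaf.app_restrict]
    exact congrFun (congrFun h B) _

/-- A sieve is determined by its values on representatives; this makes `smallCovers` a small family.
-/
instance small_linearSieve (A : C) : Small.{v} (LinearSieve k A) := by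
  refine small_of_injective (β := ∀ B : SmallModel.{v} C, Submodule k (representative B ⟶ A))
    (f := fun R B => R.hom (representative B)) fun R S h => ?_
  have key : ∀ {R S : LinearSieve k A} (_ : ∀ B, R.hom (representative B) =
      S.hom (representative B)) (D : C) (f : D ⟶ A), f ∈ R.hom D → f ∈ S.hom D := by
    intro R S h D f hf
    obtain ⟨B, ⟨e⟩⟩ := exists_iso_representative D
    have := R.comp_mem e.hom hf
    rw [h] at this
    simpa using S.comp_mem e.inv this
  exact LinearSieve.ext_mem fun D f =>
    ⟨key (congrFun h) D f, key (fun B => (congrFun h B).symm) D f⟩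

variable (k C) in
/-- The representable presheaves on a small family of representatives of the objects. -/
abbrev smallRepresentables : ObjectProperty (LinearPresheaf k C) :=
  ObjectProperty.ofObj fun B : SmallModel.{v} C => (yonedaEmbedding k C).obj (representative B)

variable (k C) in
lemma isStrongGenerator_smallRepresentables : (smallRepresentables k C).IsStrongGenerator := by
  rw [ObjectProperty.isStrongGenerator_iff]
  have hsep : (smallRepresentables k C).IsSeparating := by
    intro F G φ ψ h
    refine LinearPresheaf.hom_ext fun A x => ?_
    obtain ⟨B, ⟨e⟩⟩ := exists_iso_representative A
    apply LinearPresheaf.restrict_injective_of_iso G e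
    rw [← LinearPresheaf.app_restrict, ← LinearPresheaf.app_restrict]
    have := congrArg (LinearPresheaf.yonedaEquiv G)
      (h _ ⟨B⟩ ((LinearPresheaf.yonedaEquiv F).symm (LinearPresheaf.restrict F e.hom x)))
    simpa only [LinearPresheaf.yonedaEquiv_comp, Equiv.apply_symm_apply] using this
  refine ⟨hsep, fun F G i _ h => LinearPresheaf.isIso_of_bijective i fun A => ⟨fun x y hxy => ?_,
    fun y => ?_⟩⟩
  · apply (LinearPresheaf.yonedaEquiv F).symm.injective
    rw [← cancel_mono i]
    apply (LinearPresheaf.yonedaEquiv G).injective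
    simpa only [LinearPresheaf.yonedaEquiv_comp, Equiv.apply_symm_apply] using hxy
  · obtain ⟨B, ⟨e⟩⟩ := exists_iso_representative A
    obtain ⟨φ, hφ⟩ := h _ ⟨B⟩
      ((LinearPresheaf.yonedaEquiv G).symm (LinearPresheaf.restrict G e.hom y))
    refine ⟨LinearPresheaf.restrict F e.inv (LinearPresheaf.yonedaEquiv F φ), ?_⟩
    have := congrArg (LinearPresheaf.yonedaEquiv G) hφ
    rw [Equiv.apply_symm_apply] at this
    rw [LinearPresheaf.app_restrict]
    apply LinearPresheaf.restrict_injective_of_iso G e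
    rw [← LinearPresheaf.restrict_comp, e.hom_inv_id, LinearPresheaf.restrict_id]
    exact this

instance isLocallyPresentable_linearPresheaf : IsLocallyPresentable.{v} (LinearPresheaf k C) := by
  have := Cardinal.fact_isRegular_aleph0
  refine ⟨Cardinal.aleph0, inferInstance, ?_⟩
  rw [IsCardinalLocallyPresentable.iff_exists_isStrongGenerator]
  refine ⟨smallRepresentables k C, inferInstance, isStrongGenerator_smallRepresentables k C, ?_⟩
  rintro _ ⟨B⟩
  exact isFinitelyPresentable_yonedaEmbedding_obj k (representative B)

end

lemma exists_common_cardinal {D : Type*} [Category D] {ι : Type v} (X : ι → D)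
    [∀ i, IsPresentable.{v} (X i)] :
    ∃ (κ : Cardinal.{v}) (_ : Fact κ.IsRegular), ∀ i, IsCardinalPresentable (X i) κ := by
  choose κ hκ hX using fun i => Functor.IsAccessible.exists_cardinal (F := coyoneda.obj (op (X i)))
  obtain ⟨κ', h₁, h₂⟩ := HasCardinalLT.exists_regular_cardinal_forall.{v}
    (fun i => (κ i).ord.ToType)
  have : Fact κ'.IsRegular := ⟨h₁⟩
  refine ⟨κ', this, fun i => ?_⟩
  have := hκ i
  have : IsCardinalPresentable (X i) (κ i) := hX i
  exact isCardinalPresentable_of_le (X i)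
    (le_of_lt (by simpa [hasCardinalLT_iff_cardinal_mk_lt] using h₂ i))

lemma isRightAdjoint_ι_isLocal_of_isLocallyPresentable {D : Type*} [Category D]
    [LocallySmall.{v} D] [HasColimitsOfSize.{v, v} D] [IsLocallyPresentable.{v} D]
    (W : MorphismProperty D) [MorphismProperty.IsSmall.{v} W] :
    W.isLocal.ι.IsRightAdjoint := by
  obtain ⟨ι, A, B, f, hf⟩ := (MorphismProperty.isSmall_iff_eq_ofHoms.{v} W).1 inferInstance
  -- `Sum.elim` bounds the presentability of all sources and targets by one cardinal.
  obtain ⟨κ, _, hκ⟩ := exists_common_cardinal (Sum.elim A B)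
  refine MorphismProperty.isRightAdjoint_ι_isLocal W κ ?_
  rintro X Y g hg
  rw [hf] at hg
  obtain ⟨i⟩ := hg
  exact ⟨hκ (Sum.inl i), hκ (Sum.inr i)⟩

/-- The sheaf condition for a sieve is invariant under isomorphisms of the base object. -/
lemma LinearPresheaf.isSheafFor_of_iso {F : LinearPresheaf k C} {A B : C} (e : B ≅ A)
    {R : LinearSieve k A} (h : IsSheafFor F (R.pullback e.hom)) : IsSheafFor F R := by
  refine ⟨fun x y hxy => F.restrict_injective_of_iso e (h.1 _ _ fun D g hg => ?_), fun s hs => ?_⟩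
  · rw [← restrict_comp, ← restrict_comp]
    exact hxy D _ hg
  · obtain ⟨x, hx⟩ := h.2 _ (hs.pullback e.hom)
    refine ⟨restrict F e.inv x, fun D g hg => ?_⟩
    have hg' : (g ≫ e.inv) ≫ e.hom ∈ R.hom D := by simpa using hg
    rw [← restrict_comp]
    refine Eq.trans ?_ (hx D (g ≫ e.inv) hg')
    exact congrArg (s D) (Subtype.ext (show g = (g ≫ e.inv) ≫ e.hom by simp))

namespace LinearTopology

variable [EssentiallySmall.{v} C] (T : LinearTopology k C)

/-- The inclusions of the covering sieves on a small family of representatives of the objects. -/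
abbrev smallCovers : MorphismProperty (LinearPresheaf k C) :=
  MorphismProperty.ofHoms
    fun R : Σ B : SmallModel.{v} C, T.cov (representative B) => R.2.1.inclusion

/-- Covers of any object transport along an isomorphism to covers of a representative, so the small
family already detects sheaves. -/
lemma isLocal_smallCovers : T.smallCovers.isLocal = T.IsSheaf := by
  ext F
  constructor
  · intro h A R hR
    obtain ⟨B, ⟨e⟩⟩ := exists_iso_representative A
    rw [LinearPresheaf.bijective_inclusion_comp_iff]
    apply LinearPresheaf.isSheafFor_of_iso e
    rw [← LinearPresheaf.bijective_inclusion_comp_iff]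
    exact h _ (MorphismProperty.ofHoms.mk
      (⟨B, _, T.pullback_mem e.hom hR⟩ : Σ B : SmallModel.{v} C, T.cov (representative B)))
  · rintro h _ _ _ ⟨B, R, hR⟩
    exact h _ R hR

instance isRightAdjoint_incl : T.incl.IsRightAdjoint := by
  change T.IsSheaf.ι.IsRightAdjoint
  rw [← T.isLocal_smallCovers]
  exact isRightAdjoint_ι_isLocal_of_isLocallyPresentable _

lemma isNoetherian_sSup {𝒮 : Set (LinearTopology k C)} (h : ∀ T ∈ 𝒮, T.IsNoetherian) :
    (sSup 𝒮).IsNoetherian :=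
  isNoetherian_of_isClosedUnderColimitsOfShape _ fun J _ _ =>
    isClosedUnderColimitsOfShape_isSheaf_sSup 𝒮 J fun T hT =>
      (h T hT).isClosedUnderColimitsOfShape J

end LinearTopology

end

end LinearTopos

end

theorem mainTheorem11 (k : Type v) [CommRing k] (C : Type u) [Category.{v} C]
    [Preadditive C] [Linear k C] [EssentiallySmall.{v} C] :
    ((∃! T : LinearTopos.LinearTopology k C, IsGreatest {T' | T'.IsSubcanonical} T) ∧
      IsGreatest {T' : LinearTopos.LinearTopology k C | T'.IsSubcanonical}
        (sSup {T' : LinearTopos.LinearTopology k C | T'.IsSubcanonical})) ∧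
    ((∃! T : LinearTopos.LinearTopology k C,
        IsGreatest {T' | T'.IsSubcanonical ∧ T'.IsNoetherian} T) ∧
      IsGreatest {T' : LinearTopos.LinearTopology k C | T'.IsSubcanonical ∧ T'.IsNoetherian}
        (sSup {T' : LinearTopos.LinearTopology k C |
          T'.IsSubcanonical ∧ T'.IsNoetherian})) := by
  have h₁ : IsGreatest {T' : LinearTopos.LinearTopology k C | T'.IsSubcanonical}
      (sSup {T' : LinearTopos.LinearTopology k C | T'.IsSubcanonical}) :=
    ⟨LinearTopos.LinearTopology.isSubcanonical_sSup fun _ hT => hT, fun _ hT => le_sSup hT⟩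
  have h₂ : IsGreatest
      {T' : LinearTopos.LinearTopology k C | T'.IsSubcanonical ∧ T'.IsNoetherian}
      (sSup {T' : LinearTopos.LinearTopology k C | T'.IsSubcanonical ∧ T'.IsNoetherian}) :=
    ⟨⟨LinearTopos.LinearTopology.isSubcanonical_sSup fun _ hT => hT.1,
      LinearTopos.LinearTopology.isNoetherian_sSup fun _ hT => hT.2⟩, fun _ hT => le_sSup hT⟩
  exact ⟨⟨⟨_, h₁, fun _ h => h.unique h₁⟩, h₁⟩, ⟨_, h₂, fun _ h => h.unique h₂⟩, h₂⟩
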